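/- Manifolds are smooth, finite-dimensional, Hausdorff, second countable and without boundary; $I=[0,1]$, and $N\times I$ is the product manifold (with boundary). Let $V$ be a finite-dimensional real vector space (for instance $V=\mathbb R^k$) and let $G\subset GL(V)$ be a subgroup. A $G$-bundle over a manifold $B$ (possibly with boundary) is a smooth vector bundle over $B$ with typical fibre $V$ together with an atlas of smooth local trivializations whose transition functions take values in $G$. An isomorphism of $G$-bundles over $B$ is a diffeomorphism $\Psi:E\to E'$ of the total spaces with $\pi'\circ\Psi=\pi$ that is linear on each fibre and that, read in the trivializations of the two atlases, is given at each point of $B$ by an element of $G$. $\mathrm{Vect}_G(B)$ is the set of isomorphism classes of $G$-bundles over $B$. A smooth map $f:C\to B$ induces $f^*:\mathrm{Vect}_G(B)\to\mathrm{Vect}_G(C)$ through the pullback bundle $f^*E=\{(x,v) : x\in C,\ v\in E_{f(x)}\}$, with the pulled back trivializations. Theorem. Let $N$ and $M$ be manifolds. 1. For every $G$-bundle $\widetilde E$ over $N\times I$ there is a $G$-bundle $E$ over $N$ such that $\widetilde E\cong \mathrm{pr}_1^*E$, where $\mathrm{pr}_1:N\times I\to N$ is the projection. 2. If $f_0,f_1:N\to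 M$ are smooth maps that are homotopic (through a continuous homotopy), then $f_0^*=f_1^*:\mathrm{Vect}_G(M)\to \mathrm{Vect}_G(N)$. 3. If $M$ is contractible, then every $G$-bundle over $M$ is trivial, that is, isomorphic to the product $G$-bundle $M\times V$. -/

import Mathlib

open Bundle
open scoped Manifold ContDiff

universe w w' w''

noncomputable section

section GBundles

variable {V : Type*} [NormedAddCommGroup V] [NormedSpace ℝ V]
  {EB : Type*} [NormedAddCommGroup EB] [NormedSpace ℝ EB]
  {HB : Type*} [TopologicalSpace HB]
  {EC : Type*} [NormedAddCommGroup EC] [NormedSpace ℝ EC]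
  {HC : Type*} [TopologicalSpace HC]

/-- A smooth `G`-vector bundle with typical fibre `V` over the manifold `B`, where `G` is a subgroup
of `GL(V) = (V ≃L[ℝ] V)`: a smooth vector bundle together with an atlas of local trivializations
(the atlas carried by Mathlib's `FiberBundle`) whose transition functions take values in `G`. -/
structure GBundle (G : Subgroup (V ≃L[ℝ] V)) (J : ModelWithCorners ℝ EB HB)
    (B : Type*) [TopologicalSpace B] [ChartedSpace HB B] where
  /-- The fibre over a point. -/
  Fiber : B → Type w
  [addCommGroup : ∀ b, AddCommGroup (Fiber b)]
  [module : ∀ b, Module ℝ (Fiber b)]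
  [topFiber : ∀ b, TopologicalSpace (Fiber b)]
  [topTotal : TopologicalSpace (TotalSpace V Fiber)]
  [fiberBundle : FiberBundle V Fiber]
  [vectorBundle : VectorBundle ℝ V Fiber]
  [contMDiffVectorBundle : ContMDiffVectorBundle ∞ V Fiber J]
  /-- Over each point common to two trivializations of the atlas, the transition function
  is an element of `G`. -/
  transition_mem : ∀ (e e' : Trivialization V (π V Fiber))
    [MemTrivializationAtlas e] [MemTrivializationAtlas e'] (b : B),
    b ∈ e.baseSet → b ∈ e'.baseSet →
      ∃ g ∈ G, ∀ v : Fiber b, (e' ⟨b, v⟩).2 = g (e ⟨b, v⟩).2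

attribute [instance] GBundle.addCommGroup GBundle.module GBundle.topFiber GBundle.topTotal
  GBundle.fiberBundle GBundle.vectorBundle GBundle.contMDiffVectorBundle

variable {G : Subgroup (V ≃L[ℝ] V)} {J : ModelWithCorners ℝ EB HB}
  {B : Type*} [TopologicalSpace B] [ChartedSpace HB B]
  {K : ModelWithCorners ℝ EC HC}
  {C : Type*} [TopologicalSpace C] [ChartedSpace HC C]

/-- An isomorphism of `G`-vector bundles over `B`: a diffeomorphism of the total spaces that
commutes with the projections, is a linear isomorphism on each fibre, and is given by an element
of `G` on each fibre with respect to the trivializations of the two atlases. -/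
structure GIso (E : GBundle.{w} G J B) (E' : GBundle.{w'} G J B) where
  /-- The linear isomorphism of the fibres over a point. -/
  equiv : ∀ b, E.Fiber b ≃ₗ[ℝ] E'.Fiber b
  contMDiff_equiv : ContMDiff (J.prod 𝓘(ℝ, V)) (J.prod 𝓘(ℝ, V)) ∞
    (fun p : TotalSpace V E.Fiber => (⟨p.1, equiv p.1 p.2⟩ : TotalSpace V E'.Fiber))
  contMDiff_symm : ContMDiff (J.prod 𝓘(ℝ, V)) (J.prod 𝓘(ℝ, V)) ∞
    (fun p : TotalSpace V E'.Fiber => (⟨p.1, (equiv p.1).symm p.2⟩ : TotalSpace V E.Fiber))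
  equiv_mem : ∀ (e : Trivialization V (π V E.Fiber)) (e' : Trivialization V (π V E'.Fiber))
    [MemTrivializationAtlas e] [MemTrivializationAtlas e'] (b : B),
    b ∈ e.baseSet → b ∈ e'.baseSet →
      ∃ g ∈ G, ∀ v : E.Fiber b, (e' ⟨b, equiv b v⟩).2 = g (e ⟨b, v⟩).2

namespace GIso

/-- The identity isomorphism. -/
def refl (E : GBundle.{w} G J B) : GIso E E where
  equiv _ := LinearEquiv.refl ℝ _
  contMDiff_equiv := contMDiff_id
  contMDiff_symm := contMDiff_id
  equiv_mem e e' _ _ b hb hb' := E.transition_mem e e' b hb hb'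

/-- The inverse isomorphism. -/
def symm {E : GBundle.{w} G J B} {E' : GBundle.{w'} G J B} (φ : GIso E E') : GIso E' E where
  equiv b := (φ.equiv b).symm
  contMDiff_equiv := φ.contMDiff_symm
  contMDiff_symm := φ.contMDiff_equiv
  equiv_mem e e' _ _ b hb hb' := by
    obtain ⟨g, hg, h⟩ := φ.equiv_mem e' e b hb' hb
    refine ⟨g⁻¹, G.inv_mem hg, fun v => ?_⟩
    have h1 := h ((φ.equiv b).symm v)
    rw [LinearEquiv.apply_symm_apply] at h1
    rw [h1]
    exact (g.symm_apply_apply _).symm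

/-- The composition of two isomorphisms. -/
def trans {E : GBundle.{w} G J B} {E' : GBundle.{w'} G J B} {E'' : GBundle.{w''} G J B}
    (φ : GIso E E') (ψ : GIso E' E'') : GIso E E'' where
  equiv b := (φ.equiv b).trans (ψ.equiv b)
  contMDiff_equiv := ψ.contMDiff_equiv.comp φ.contMDiff_equiv
  contMDiff_symm := φ.contMDiff_symm.comp ψ.contMDiff_symm
  equiv_mem e e'' _ _ b hb hb'' := by
    obtain ⟨g, hg, h⟩ := φ.equiv_mem e (trivializationAt V E'.Fiber b) b hb
      (mem_baseSet_trivializationAt V E'.Fiber b)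
    obtain ⟨g', hg', h'⟩ := ψ.equiv_mem (trivializationAt V E'.Fiber b) e'' b
      (mem_baseSet_trivializationAt V E'.Fiber b) hb''
    refine ⟨g' * g, G.mul_mem hg' hg, fun v => ?_⟩
    change (e'' ⟨b, ψ.equiv b (φ.equiv b v)⟩).2 = g' (g _)
    rw [h', h]

end GIso

namespace GBundle

/-- The product `G`-bundle `B × V → B`. -/
def trivial (G : Subgroup (V ≃L[ℝ] V)) (J : ModelWithCorners ℝ EB HB)
    (B : Type*) [TopologicalSpace B] [ChartedSpace HB B] : GBundle G J B where
  Fiber := Bundle.Trivial B V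
  transition_mem e e' he he' b _ _ := by
    have h := Bundle.Trivial.eq_trivialization B V e
    have h' := Bundle.Trivial.eq_trivialization B V e'
    subst h h'
    exact ⟨1, G.one_mem, fun _ => rfl⟩

/-- The pullback `f^* E` of a `G`-bundle under a smooth map `f : C → B`; its fibre over `c` is
`E_{f(c)}` and its atlas consists of the pullbacks of the trivializations of `E`. -/
def pullback (f : C^∞⟮K, C; J, B⟯) (E : GBundle.{w} G J B) : GBundle.{w} G K C where
  Fiber := (f : C → B) *ᵖ E.Fiber
  addCommGroup := fun c => inferInstanceAs (AddCommGroup (E.Fiber (f c)))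
  contMDiffVectorBundle := ContMDiffVectorBundle.pullback V E.Fiber K f
  transition_mem := by
    rintro _ _ ⟨e, he, rfl⟩ ⟨e', he', rfl⟩ b hb hb'
    exact E.transition_mem e e' (f b) hb hb'

end GBundle

/-- The canonical map `f^* E → E` of total spaces is smooth. -/
theorem GBundle.contMDiff_lift (f : C^∞⟮K, C; J, B⟯) (E : GBundle.{w} G J B) :
    ContMDiff (K.prod 𝓘(ℝ, V)) (J.prod 𝓘(ℝ, V)) ∞
      (fun p : TotalSpace V (E.pullback f).Fiber =>
        (⟨f p.1, p.2⟩ : TotalSpace V E.Fiber)) := by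
  intro p
  rw [contMDiffAt_totalSpace]
  have hid : ContMDiffAt (K.prod 𝓘(ℝ, V)) (K.prod 𝓘(ℝ, V)) ∞
    (fun q : TotalSpace V (E.pullback f).Fiber => q) p := contMDiffAt_id
  rw [contMDiffAt_totalSpace] at hid
  exact ⟨f.contMDiff.contMDiffAt.comp p hid.1, hid.2⟩

/-- A map into `f^* E` is smooth if its base component and its composition with `f^* E → E` are. -/
theorem GBundle.contMDiff_pullback {EX : Type*} [NormedAddCommGroup EX] [NormedSpace ℝ EX]
    {HX : Type*} [TopologicalSpace HX] {L : ModelWithCorners ℝ EX HX} {X : Type*}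
    [TopologicalSpace X] [ChartedSpace HX X] (f : C^∞⟮K, C; J, B⟯) (E : GBundle.{w} G J B)
    {F : X → TotalSpace V (E.pullback f).Fiber} (h₁ : ContMDiff L K ∞ (fun x => (F x).1))
    (h₂ : ContMDiff L (J.prod 𝓘(ℝ, V)) ∞
      (fun x => (⟨f (F x).1, (F x).2⟩ : TotalSpace V E.Fiber))) :
    ContMDiff L (K.prod 𝓘(ℝ, V)) ∞ F := by
  intro x
  rw [contMDiffAt_totalSpace]
  have h := h₂ x
  rw [contMDiffAt_totalSpace] at h
  exact ⟨h₁ x, h.2⟩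

/-- The pullback of an isomorphism of `G`-bundles. -/
def GIso.pullback (f : C^∞⟮K, C; J, B⟯) {E : GBundle.{w} G J B} {E' : GBundle.{w'} G J B}
    (φ : GIso E E') : GIso (E.pullback f) (E'.pullback f) where
  equiv c := φ.equiv (f c)
  contMDiff_equiv := GBundle.contMDiff_pullback f E' (contMDiff_proj _)
    (φ.contMDiff_equiv.comp (GBundle.contMDiff_lift f E))
  contMDiff_symm := GBundle.contMDiff_pullback f E (contMDiff_proj _)
    (φ.contMDiff_symm.comp (GBundle.contMDiff_lift f E'))
  equiv_mem := by
    rintro _ _ ⟨e, he, rfl⟩ ⟨e', he', rfl⟩ c hc hc'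
    exact φ.equiv_mem e e' (f c) hc hc'

/-- Isomorphism of `G`-bundles over `B` as an equivalence relation. -/
instance GBundle.isoSetoid (G : Subgroup (V ≃L[ℝ] V)) (J : ModelWithCorners ℝ EB HB)
    (B : Type*) [TopologicalSpace B] [ChartedSpace HB B] : Setoid (GBundle.{w} G J B) where
  r E E' := Nonempty (GIso E E')
  iseqv := ⟨fun E => ⟨GIso.refl E⟩, fun ⟨φ⟩ => ⟨φ.symm⟩, fun ⟨φ⟩ ⟨ψ⟩ => ⟨φ.trans ψ⟩⟩

/-- `Vect_G(B)`: the isomorphism classes of `G`-bundles over `B`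
(with fibres in the universe `w`). -/
def VectG (G : Subgroup (V ≃L[ℝ] V)) (J : ModelWithCorners ℝ EB HB)
    (B : Type*) [TopologicalSpace B] [ChartedSpace HB B] :=
  Quotient (GBundle.isoSetoid.{w} G J B)

/-- The map `f^* : Vect_G(B) → Vect_G(C)` induced by a smooth map `f : C → B`. -/
def VectG.pullback (G : Subgroup (V ≃L[ℝ] V)) (f : C^∞⟮K, C; J, B⟯) :
    VectG.{w} G J B → VectG.{w} G K C :=
  Quotient.map (fun E => E.pullback f) (fun _ _ ⟨φ⟩ => ⟨φ.pullback f⟩)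

end GBundles

end

open Filter Topology Set Function

/-! A map of `G`-bundles covering a smooth `f` identifies its source with the pullback of its target
along `f` (`IsGMap.nonempty_gIso`). Claim 1 therefore reduces to a self-map of the bundle over `N ×
I` covering `(x, t) ↦ (x, 1)`; the bundle over `N` is then the restriction to the top.

Since `G` is an arbitrary subgroup, this map is not obtained from a connection. Over a box inside
one trivialization, base points are moved upwards while the vector coordinate is kept
(`exists_push_box`); in other trivializations of the atlas this reads as a product of transition
elements, hence lies in `G`. A supremum argument on the height reached yields a push up to height
`1` near each point of `N` (`exists_isPush`), and an infinite, locally finite composition of such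
pushes, cut off by bump functions, reaches height `1` everywhere (`exists_isGMap_slice_one`).

Consequently all slices of a bundle over `N × I` are isomorphic. For claim 2, a continuous homotopy
is made smooth relative to its ends, one chart at a time (`exists_contMDiffMap_eqOn`), and the
bundle is pulled back along it. Claim 3 compares the identity with a constant map. -/

noncomputable section

/-! ### Smoothness of operator-valued maps -/

section OperatorValued

variable {V W : Type*} [NormedAddCommGroup V] [NormedSpace ℝ V] [FiniteDimensional ℝ V]
  [NormedAddCommGroup W] [NormedSpace ℝ W]
  {EB : Type*} [NormedAddCommGroup EB] [NormedSpace ℝ EB]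
  {HB : Type*} [TopologicalSpace HB] {J : ModelWithCorners ℝ EB HB}
  {B : Type*} [TopologicalSpace B] [ChartedSpace HB B]

/-- A family of operators on a finite-dimensional space is smooth if it is pointwise smooth. -/
theorem contMDiffAt_clm_of_apply {A : B → V →L[ℝ] W} {b : B}
    (h : ∀ v, ContMDiffAt J 𝓘(ℝ, W) ∞ (fun x => A x v) b) :
    ContMDiffAt J 𝓘(ℝ, V →L[ℝ] W) ∞ A b := by
  let β := Module.finBasis ℝ V
  -- An operator is the sum of the rank-one operators built from its values on a basis, so `A`
  -- depends linearly on finitely many smooth vectors.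
  have hA : A = fun x => ∑ i, ContinuousLinearMap.smulRightL ℝ V W
      (LinearMap.toContinuousLinearMap (β.coord i)) (A x (β i)) := by
    funext x
    ext v
    conv_lhs => rw [← β.sum_repr v, map_sum]
    simp
  rw [hA]
  refine contMDiffAt_finsetSum fun i _ => ?_
  exact (ContinuousLinearMap.contMDiff _).contMDiffAt.comp b (h (β i))

end OperatorValued

/-! ### Maps of `G`-bundles covering a map of the bases -/

section GMaps

variable {V : Type*} [NormedAddCommGroup V] [NormedSpace ℝ V]
  {G : Subgroup (V ≃L[ℝ] V)}
  {EB : Type*} [NormedAddCommGroup EB] [NormedSpace ℝ EB]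
  {HB : Type*} [TopologicalSpace HB] {J : ModelWithCorners ℝ EB HB}
  {B : Type*} [TopologicalSpace B] [ChartedSpace HB B]
  {EC : Type*} [NormedAddCommGroup EC] [NormedSpace ℝ EC]
  {HC : Type*} [TopologicalSpace HC] {K : ModelWithCorners ℝ EC HC}
  {C : Type*} [TopologicalSpace C] [ChartedSpace HC C]
  {ED : Type*} [NormedAddCommGroup ED] [NormedSpace ℝ ED]
  {HD : Type*} [TopologicalSpace HD] {L : ModelWithCorners ℝ ED HD}
  {D : Type*} [TopologicalSpace D] [ChartedSpace HD D]

/-- Over the point `b`, the map `F` of total spaces is a smooth map of `G`-bundles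
covering `f`. -/
structure IsGMapAt (E : GBundle.{w} G J B) (E' : GBundle.{w'} G K C)
    (F : TotalSpace V E.Fiber → TotalSpace V E'.Fiber) (f : B → C) (b : B) : Prop where
  proj : ∀ v : E.Fiber b, (F ⟨b, v⟩).1 = f b
  contMDiffAt : ∀ v : E.Fiber b,
    ContMDiffAt (J.prod 𝓘(ℝ, V)) (K.prod 𝓘(ℝ, V)) ∞ F ⟨b, v⟩
  mem : ∀ (e : Trivialization V (π V E.Fiber)) (e' : Trivialization V (π V E'.Fiber))
    [MemTrivializationAtlas e] [MemTrivializationAtlas e'],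
    b ∈ e.baseSet → f b ∈ e'.baseSet →
      ∃ g ∈ G, ∀ v : E.Fiber b, (e' (F ⟨b, v⟩)).2 = g (e ⟨b, v⟩).2

/-- A smooth map of `G`-bundles covering `f`. -/
def IsGMap (E : GBundle.{w} G J B) (E' : GBundle.{w'} G K C)
    (F : TotalSpace V E.Fiber → TotalSpace V E'.Fiber) (f : B → C) : Prop :=
  ∀ b, IsGMapAt E E' F f b

theorem isGMap_id (E : GBundle.{w} G J B) : IsGMap E E id id := fun b =>
  ⟨fun _ => rfl, fun _ => contMDiffAt_id, fun e e' _ _ hb hb' => E.transition_mem e e' b hb hb'⟩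

/-- Smoothness is asked of the total map alone, so the base maps need to agree only at `b`. This is
the tool for gluing maps defined piecewise over the base. -/
theorem IsGMapAt.congr {E : GBundle.{w} G J B} {E' : GBundle.{w'} G K C}
    {F F₁ : TotalSpace V E.Fiber → TotalSpace V E'.Fiber} {f f₁ : B → C} {b : B}
    (h : IsGMapAt E E' F f b) (hF : ∀ᶠ x in 𝓝 b, ∀ v : E.Fiber x, F₁ ⟨x, v⟩ = F ⟨x, v⟩)
    (hf : f₁ b = f b) : IsGMapAt E E' F₁ f₁ b where
  proj v := by rw [hF.self_of_nhds v, h.proj, hf]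
  contMDiffAt v := by
    refine (h.contMDiffAt v).congr_of_eventuallyEq ?_
    have hc : Continuous (π V E.Fiber) := FiberBundle.continuous_proj V E.Fiber
    have hp : Tendsto (π V E.Fiber) (𝓝 ⟨b, v⟩) (𝓝 b) := hc.tendsto' _ _ rfl
    filter_upwards [hp.eventually hF] with p hp'
    exact hp' p.2
  mem e e' _ _ hb hb' := by
    obtain ⟨g, hg, H⟩ := h.mem e e' hb (hf ▸ hb')
    exact ⟨g, hg, fun v => by rw [hF.self_of_nhds v, H]⟩

theorem IsGMapAt.comp {E : GBundle.{w} G J B} {E' : GBundle.{w'} G K C} {E'' : GBundle.{w''} G L D}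
    {F : TotalSpace V E.Fiber → TotalSpace V E'.Fiber} {f : B → C} {b : B}
    {F' : TotalSpace V E'.Fiber → TotalSpace V E''.Fiber} {f' : C → D}
    (h' : IsGMapAt E' E'' F' f' (f b)) (h : IsGMapAt E E' F f b) :
    IsGMapAt E E'' (F' ∘ F) (f' ∘ f) b := by
  have key : ∀ v, ∃ u : E'.Fiber (f b), F ⟨b, v⟩ = ⟨f b, u⟩ := fun v => by
    have := h.proj v
    rcases hp : F ⟨b, v⟩ with ⟨c, u⟩
    rw [hp] at this
    dsimp at this
    subst this
    exact ⟨u, rfl⟩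
  refine ⟨fun v => ?_, fun v => ?_, fun e e'' _ _ hb hb'' => ?_⟩
  · obtain ⟨u, hu⟩ := key v
    rw [comp_apply, hu, h'.proj, comp_apply]
  · obtain ⟨u, hu⟩ := key v
    exact ContMDiffAt.comp _ (hu ▸ h'.contMDiffAt u) (h.contMDiffAt v)
  · obtain ⟨g, hg, H⟩ := h.mem e (trivializationAt V E'.Fiber (f b)) hb
      (mem_baseSet_trivializationAt V E'.Fiber (f b))
    obtain ⟨g', hg', H'⟩ := h'.mem (trivializationAt V E'.Fiber (f b)) e''
      (mem_baseSet_trivializationAt V E'.Fiber (f b)) hb''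
    refine ⟨g' * g, G.mul_mem hg' hg, fun v => ?_⟩
    obtain ⟨u, hu⟩ := key v
    change _ = g' (g _)
    rw [← H, comp_apply, hu, H']

theorem IsGMap.comp {E : GBundle.{w} G J B} {E' : GBundle.{w'} G K C} {E'' : GBundle.{w''} G L D}
    {F : TotalSpace V E.Fiber → TotalSpace V E'.Fiber} {f : B → C}
    {F' : TotalSpace V E'.Fiber → TotalSpace V E''.Fiber} {f' : C → D}
    (h' : IsGMap E' E'' F' f') (h : IsGMap E E' F f) : IsGMap E E'' (F' ∘ F) (f' ∘ f) :=
  fun b => (h' (f b)).comp (h b)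

/-- The map of `G`-bundles that is the identity of `V` in a trivialization, over a map `φ` of the
base. -/
theorem isGMapAt_trivialization {E : GBundle.{w} G J B}
    (e : Trivialization V (π V E.Fiber)) [MemTrivializationAtlas e] {φ : B → B} {b : B}
    (hφ : ContMDiffAt J J ∞ φ b) (hb : b ∈ e.baseSet) (hφb : φ b ∈ e.baseSet) :
    IsGMapAt E E (fun p => e.toOpenPartialHomeomorph.symm (φ p.1, (e p).2)) φ b where
  proj v := e.proj_symm_apply' hφb
  contMDiffAt v := by
    have h1 : ContMDiffAt (J.prod 𝓘(ℝ, V)) (J.prod 𝓘(ℝ, V)) ∞ e.toOpenPartialHomeomorph.symm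
        (φ b, (e ⟨b, v⟩).2) :=
      e.contMDiffOn_symm.contMDiffAt (e.open_target.mem_nhds (by rw [e.mem_target]; exact hφb))
    have h2 : ContMDiffAt (J.prod 𝓘(ℝ, V)) (J.prod 𝓘(ℝ, V)) ∞ e (⟨b, v⟩ : TotalSpace V E.Fiber) :=
      e.contMDiffOn.contMDiffAt (e.open_source.mem_nhds (by rw [e.mem_source]; exact hb))
    have h3 : ContMDiffAt (J.prod 𝓘(ℝ, V)) J ∞ (fun p : TotalSpace V E.Fiber => φ p.1) ⟨b, v⟩ :=
      ContMDiffAt.comp (⟨b, v⟩ : TotalSpace V E.Fiber) hφ (contMDiffAt_proj E.Fiber)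
    exact ContMDiffAt.comp (⟨b, v⟩ : TotalSpace V E.Fiber) h1 (h3.prodMk h2.snd)
  mem e₁ e₂ _ _ hb₁ hb₂ := by
    -- The map is the identity of `V` in `e`, so from `e₁` to `e₂` it is a transition at `b`
    -- followed by one at `φ b`.
    obtain ⟨g₁, hg₁, h₁⟩ := E.transition_mem e₁ e b hb₁ hb
    obtain ⟨g₂, hg₂, h₂⟩ := E.transition_mem e e₂ (φ b) hφb hb₂
    refine ⟨g₂ * g₁, G.mul_mem hg₂ hg₁, fun v => ?_⟩
    change _ = g₂ (g₁ _)
    rw [← h₁, ← e.mk_symm hφb, h₂, e.apply_mk_symm hφb]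

end GMaps

/-! ### From maps of `G`-bundles to isomorphisms with pullbacks -/

section Iso

variable {V : Type*} [NormedAddCommGroup V] [NormedSpace ℝ V]
  {G : Subgroup (V ≃L[ℝ] V)}
  {EB : Type*} [NormedAddCommGroup EB] [NormedSpace ℝ EB]
  {HB : Type*} [TopologicalSpace HB] {J : ModelWithCorners ℝ EB HB}
  {B : Type*} [TopologicalSpace B] [ChartedSpace HB B]
  {EC : Type*} [NormedAddCommGroup EC] [NormedSpace ℝ EC]
  {HC : Type*} [TopologicalSpace HC] {K : ModelWithCorners ℝ EC HC}
  {C : Type*} [TopologicalSpace C] [ChartedSpace HC C]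

/-- A smooth fibrewise linear map given by elements of `G` has a smooth inverse. -/
theorem contMDiff_symm_of_mem [FiniteDimensional ℝ V] {E : GBundle.{w} G J B}
    {E' : GBundle.{w'} G J B} (φ : ∀ b, E.Fiber b ≃ₗ[ℝ] E'.Fiber b)
    (h : ContMDiff (J.prod 𝓘(ℝ, V)) (J.prod 𝓘(ℝ, V)) ∞
      (fun p : TotalSpace V E.Fiber => (⟨p.1, φ p.1 p.2⟩ : TotalSpace V E'.Fiber)))
    (hG : ∀ (e : Trivialization V (π V E.Fiber)) (e' : Trivialization V (π V E'.Fiber))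
      [MemTrivializationAtlas e] [MemTrivializationAtlas e'] (b : B),
      b ∈ e.baseSet → b ∈ e'.baseSet →
        ∃ g ∈ G, ∀ v : E.Fiber b, (e' ⟨b, φ b v⟩).2 = g (e ⟨b, v⟩).2) :
    ContMDiff (J.prod 𝓘(ℝ, V)) (J.prod 𝓘(ℝ, V)) ∞
      (fun p : TotalSpace V E'.Fiber => (⟨p.1, (φ p.1).symm p.2⟩ : TotalSpace V E.Fiber)) := by
  rintro ⟨b₀, w₀⟩
  let e := trivializationAt V E.Fiber b₀
  let e' := trivializationAt V E'.Fiber b₀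
  have hb : b₀ ∈ e.baseSet := mem_baseSet_trivializationAt V E.Fiber b₀
  have hb' : b₀ ∈ e'.baseSet := mem_baseSet_trivializationAt V E'.Fiber b₀
  have hU : ∀ᶠ b in 𝓝 b₀, b ∈ e.baseSet ∧ b ∈ e'.baseSet :=
    (e.open_baseSet.eventually_mem hb).and (e'.open_baseSet.eventually_mem hb')
  -- The family read in the two trivializations. Smoothness of the inverse then follows from
  -- smoothness of operator inversion at an invertible operator; values away from the common base
  -- set play no role.
  let A : B → V →L[ℝ] V := fun b =>
    LinearMap.toContinuousLinearMap (e'.linearMapAt ℝ b ∘ₗ (φ b).toLinearMap ∘ₗ e.symmₗ ℝ b)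
  have hAapp : ∀ b, b ∈ e.baseSet → b ∈ e'.baseSet → ∀ v : E.Fiber b,
      A b (e ⟨b, v⟩).2 = (e' ⟨b, φ b v⟩).2 := fun b h1 h2 v => by
    change e'.linearMapAt ℝ b (φ b (e.symmₗ ℝ b (e ⟨b, v⟩).2)) = _
    have : (e ⟨b, v⟩).2 = e.linearMapAt ℝ b v := by
      rw [e.coe_linearMapAt_of_mem h1]
    rw [this, e.symmₗ_linearMapAt h1, e'.coe_linearMapAt_of_mem h2]
  have hAsurj : ∀ b, b ∈ e.baseSet → ∀ w : V, ∃ v : E.Fiber b, (e ⟨b, v⟩).2 = w :=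
    fun b h1 w => ⟨(e.linearEquivAt ℝ b h1).symm w, (e.linearEquivAt ℝ b h1).apply_symm_apply w⟩
  have hAeq : ∀ b, b ∈ e.baseSet → b ∈ e'.baseSet → ∃ g : V ≃L[ℝ] V, A b = g := by
    intro b h1 h2
    obtain ⟨g, -, hg⟩ := hG e e' b h1 h2
    refine ⟨g, ContinuousLinearMap.ext fun w => ?_⟩
    obtain ⟨v, rfl⟩ := hAsurj b h1 w
    rw [hAapp b h1 h2, hg]
    rfl
  have hA : ContMDiffAt J 𝓘(ℝ, V →L[ℝ] V) ∞ A b₀ := by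
    refine contMDiffAt_clm_of_apply fun v => ?_
    have hs : ContMDiffAt J (J.prod 𝓘(ℝ, V)) ∞
        (fun b => (⟨b, e.symmₗ ℝ b v⟩ : TotalSpace V E.Fiber)) b₀ := by
      refine (e.contMDiffAt_section_iff hb).2 ?_
      refine (contMDiffAt_const (c := v)).congr_of_eventuallyEq ?_
      filter_upwards [hU] with b hb1
      have := e.linearMapAt_symmₗ hb1.1 v (R := ℝ)
      rwa [e.coe_linearMapAt_of_mem hb1.1] at this
    have h2 := ContMDiffAt.comp b₀ (h _) hs
    have h3 := (e'.contMDiffAt_section_iff (s := fun b => φ b (e.symmₗ ℝ b v)) hb').1 h2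
    refine h3.congr_of_eventuallyEq ?_
    filter_upwards [hU] with b hb1
    change e'.linearMapAt ℝ b (φ b (e.symmₗ ℝ b v)) = _
    rw [e'.coe_linearMapAt_of_mem hb1.2]
  have hinv : ContMDiffAt J 𝓘(ℝ, V →L[ℝ] V) ∞ (fun b => (A b).inverse) b₀ := by
    obtain ⟨g, hg⟩ := hAeq b₀ hb hb'
    have := contDiffAt_map_inverse (n := ∞) g
    rw [← hg] at this
    exact this.contMDiffAt.comp b₀ hA
  have hproj : ContMDiffAt (J.prod 𝓘(ℝ, V)) J ∞ (π V E'.Fiber) ⟨b₀, w₀⟩ := contMDiffAt_proj E'.Fiber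
  refine (e.contMDiffAt_iff (by rw [e.mem_source]; exact hb)).2 ⟨hproj, ?_⟩
  have h4 : ContMDiffAt (J.prod 𝓘(ℝ, V)) 𝓘(ℝ, V) ∞
      (fun p : TotalSpace V E'.Fiber => (e' p).2) ⟨b₀, w₀⟩ :=
    ((e'.contMDiffAt_iff (f := id) (by rw [e'.mem_source]; exact hb')).1 contMDiffAt_id).2
  have h5 : ContMDiffAt (J.prod 𝓘(ℝ, V)) 𝓘(ℝ, V →L[ℝ] V) ∞
      (fun p : TotalSpace V E'.Fiber => (A p.1).inverse) ⟨b₀, w₀⟩ :=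
    ContMDiffAt.comp (⟨b₀, w₀⟩ : TotalSpace V E'.Fiber) hinv hproj
  refine (h5.clm_apply h4).congr_of_eventuallyEq ?_
  filter_upwards [hproj.continuousAt.eventually hU] with p hp
  obtain ⟨g, hg⟩ := hAeq p.1 hp.1 hp.2
  have := hAapp p.1 hp.1 hp.2 ((φ p.1).symm p.2)
  rw [LinearEquiv.apply_symm_apply, hg] at this
  rw [hg, ContinuousLinearMap.inverse_equiv]
  exact (g.symm_apply_eq.2 this.symm).symm

/-- A smooth map of `G`-bundles over a smooth map `f` induces an isomorphism with the pullback
along `f`. -/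
theorem IsGMap.nonempty_gIso [FiniteDimensional ℝ V] {E : GBundle.{w} G J B}
    {E' : GBundle.{w'} G K C} {f : C^∞⟮J, B; K, C⟯}
    {F : TotalSpace V E.Fiber → TotalSpace V E'.Fiber} (h : IsGMap E E' F f) :
    Nonempty (GIso E (E'.pullback f)) := by
  -- On the fibre over `b`, `F` is `g` conjugated by two trivializations, hence linear and bijective
  -- although neither was assumed.
  have key : ∀ b, ∃ φ : E.Fiber b ≃ₗ[ℝ] E'.Fiber (f b), ∀ v, F ⟨b, v⟩ = ⟨f b, φ v⟩ := by
    intro b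
    let e := trivializationAt V E.Fiber b
    let e' := trivializationAt V E'.Fiber (f b)
    have hb : b ∈ e.baseSet := mem_baseSet_trivializationAt V E.Fiber b
    have hb' : f b ∈ e'.baseSet := mem_baseSet_trivializationAt V E'.Fiber (f b)
    obtain ⟨g, -, hg⟩ := (h b).mem e e' hb hb'
    refine ⟨(e.linearEquivAt ℝ b hb).trans
      (g.toLinearEquiv.trans (e'.linearEquivAt ℝ (f b) hb').symm), fun v => ?_⟩
    have h1 : F ⟨b, v⟩ ∈ e'.source := by rw [e'.mem_source, (h b).proj]; exact hb'
    have h2 : ∀ u, (⟨f b, u⟩ : TotalSpace V E'.Fiber) ∈ e'.source := fun u => by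
      rw [e'.mem_source]; exact hb'
    refine e'.injOn h1 (h2 _) (Prod.ext ?_ ?_)
    · rw [Trivialization.coe_coe, e'.coe_fst h1, e'.coe_fst (h2 _), (h b).proj]
    · refine (hg v).trans ?_
      exact ((e'.linearEquivAt ℝ (f b) hb').apply_symm_apply _).symm
  choose φ hφ using key
  have hsm : ContMDiff (J.prod 𝓘(ℝ, V)) (J.prod 𝓘(ℝ, V)) ∞ (fun p : TotalSpace V E.Fiber =>
      (⟨p.1, φ p.1 p.2⟩ : TotalSpace V (E'.pullback f).Fiber)) := by
    refine GBundle.contMDiff_pullback f E' (contMDiff_proj _) fun p => ?_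
    exact ((h p.1).contMDiffAt p.2).congr_of_eventuallyEq
      (Eventually.of_forall fun q => (hφ q.1 q.2).symm)
  have hmem : ∀ (e : Trivialization V (π V E.Fiber))
      (e' : Trivialization V (π V (E'.pullback f).Fiber))
      [MemTrivializationAtlas e] [MemTrivializationAtlas e'] (b : B),
      b ∈ e.baseSet → b ∈ e'.baseSet →
        ∃ g ∈ G, ∀ v : E.Fiber b,
          (e' (⟨b, φ b v⟩ : TotalSpace V (E'.pullback f).Fiber)).2 = g (e ⟨b, v⟩).2 := by
    rintro e _ _ ⟨e', he', rfl⟩ b hb hb'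
    obtain ⟨g, hg, H⟩ := (h b).mem e e' hb hb'
    refine ⟨g, hg, fun v => ?_⟩
    rw [← H, hφ]
    rfl
  exact ⟨⟨φ, hsm, contMDiff_symm_of_mem (E' := E'.pullback f) φ hsm hmem, hmem⟩⟩

end Iso

end

noncomputable section

/-! ### Pushing a bundle over the cylinder upwards -/

section Push

variable {V : Type*} [NormedAddCommGroup V] [NormedSpace ℝ V]
  {G : Subgroup (V ≃L[ℝ] V)}
  {EN : Type*} [NormedAddCommGroup EN] [NormedSpace ℝ EN]
  {HN : Type*} [TopologicalSpace HN] {J : ModelWithCorners ℝ EN HN}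
  {N : Type*} [TopologicalSpace N] [ChartedSpace HN N]

/-- `T` is a `G`-map covering `(x, t) ↦ (x, s (x, t))` that moves points upwards, up to height at
least `b` where `χ = 1`, and moves nothing where `χ = 0`. -/
structure IsPush (E : GBundle.{w} G (J.prod (𝓡∂ 1)) (N × unitInterval)) (χ : N → ℝ) (b : ℝ)
    (T : TotalSpace V E.Fiber → TotalSpace V E.Fiber) (s : N × unitInterval → unitInterval) :
    Prop where
  isGMap : IsGMap E E T (fun q => (q.1, s q))
  le_apply : ∀ q, q.2 ≤ s q
  height : ∀ q : N × unitInterval, χ q.1 = 1 → b ≤ s q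
  fixed : ∀ p : TotalSpace V E.Fiber, χ p.1.1 = 0 → T p = p

/-- Inside the box the bundle is a product, so any self-map of the base preserving the box lifts
with the vector coordinate unchanged. A cutoff in both directions makes the base map the identity
near the frontier of the box, where the lift is continued by the identity. -/
theorem exists_push_box {E : GBundle.{w} G (J.prod (𝓡∂ 1)) (N × unitInterval)}
    (e : Trivialization V (π V E.Fiber)) [MemTrivializationAtlas e] {U : Set N} (hU : IsOpen U)
    {c ε : ℝ} (hc : c ∈ Icc (0 : ℝ) 1) (hε : 0 < ε)
    (hbox : ∀ x ∈ U, ∀ t : unitInterval, |(t : ℝ) - c| < 3 * ε → (x, t) ∈ e.baseSet)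
    {χ : N → ℝ} (hχ : ContMDiff J 𝓘(ℝ, ℝ) ∞ χ) (hχ01 : ∀ x, χ x ∈ Icc (0 : ℝ) 1)
    (hχU : tsupport χ ⊆ U) :
    ∃ T : TotalSpace V E.Fiber → TotalSpace V E.Fiber, ∃ s : N × unitInterval → unitInterval,
      IsGMap E E T (fun q => (q.1, s q)) ∧ (∀ q, q.2 ≤ s q) ∧
      (∀ q : N × unitInterval, χ q.1 = 1 → |(q.2 : ℝ) - c| ≤ ε → min 1 (c + 2 * ε) ≤ s q) ∧
      (∀ p : TotalSpace V E.Fiber, χ p.1.1 = 0 → T p = p) := by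
  classical
  let β : ContDiffBump c := ⟨ε, 2 * ε, hε, by linarith⟩
  -- The height aimed at: truncated at `1` to stay in `I`, and within `3 * ε` of `c` to stay in the
  -- box.
  set h : ℝ := min 1 (c + 2 * ε) with hh
  have hh1 : h ≤ 1 := min_le_left _ _
  have hh2 : h ≤ c + 2 * ε := min_le_right _ _
  have hch : c ≤ h := le_min hc.2 (by linarith)
  have hβ0 : ∀ t : ℝ, 2 * ε ≤ |t - c| → β t = 0 := fun t ht => by
    refine β.zero_of_le_dist ?_
    rw [Real.dist_eq]; exact ht
  let lam : N × unitInterval → ℝ := fun q => χ q.1 * β q.2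
  have hlam0 : ∀ q, 0 ≤ lam q := fun q => mul_nonneg (hχ01 _).1 β.nonneg
  have hlam1 : ∀ q, lam q ≤ 1 := fun q => mul_le_one₀ (hχ01 _).2 β.nonneg β.le_one
  -- Being a convex combination of the old height and `h`, the new height stays in both convex sets,
  -- `[0, 1]` and the box.
  let r : N × unitInterval → ℝ := fun q => (1 - lam q) * q.2 + lam q * h
  have hr : ∀ q, r q ∈ Icc (0 : ℝ) 1 := fun q =>
    convex_Icc (0 : ℝ) 1 q.2.2 ⟨hc.1.trans hch, hh1⟩ (sub_nonneg.2 (hlam1 q)) (hlam0 q) (by ring)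
  have hrbox : ∀ q : N × unitInterval, |(q.2 : ℝ) - c| < 3 * ε → |r q - c| < 3 * ε := fun q hq => by
    have h1 : (q.2 : ℝ) ∈ Metric.ball c (3 * ε) := by rwa [Metric.mem_ball, Real.dist_eq]
    have h2 : h ∈ Metric.ball c (3 * ε) := by
      rw [Metric.mem_ball, Real.dist_eq, abs_lt]; constructor <;> linarith
    have := convex_ball c (3 * ε) h1 h2 (sub_nonneg.2 (hlam1 q)) (hlam0 q) (by ring)
    rwa [Metric.mem_ball, Real.dist_eq] at this
  let s : N × unitInterval → unitInterval := fun q => ⟨r q, hr q⟩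
  let φ : N × unitInterval → N × unitInterval := fun q => (q.1, s q)
  have hsnd : ContMDiff (J.prod (𝓡∂ 1)) 𝓘(ℝ, ℝ) ∞ (fun q : N × unitInterval => (q.2 : ℝ)) :=
    contMDiff_subtypeVal_Icc.comp contMDiff_snd
  have hlam : ContMDiff (J.prod (𝓡∂ 1)) 𝓘(ℝ, ℝ) ∞ lam :=
    (hχ.comp contMDiff_fst).mul (β.contDiff.contMDiff.comp hsnd)
  have hrs : ContMDiff (J.prod (𝓡∂ 1)) 𝓘(ℝ, ℝ) ∞ r :=
    ((contMDiff_const.sub hlam).mul hsnd).add (hlam.mul contMDiff_const)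
  have hs : ContMDiff (J.prod (𝓡∂ 1)) (𝓡∂ 1) ∞ s :=
    contMDiff_iff_comp_subtypeVal_Icc.2 ⟨hrs.continuous.subtype_mk _, hrs⟩
  have hφ : ContMDiff (J.prod (𝓡∂ 1)) (J.prod (𝓡∂ 1)) ∞ φ := contMDiff_fst.prodMk hs
  have hfix : ∀ q, lam q = 0 → φ q = q := fun q hq =>
    Prod.ext rfl (Subtype.ext (by change r q = q.2; simp only [r, hq]; ring))
  let W : Set (N × unitInterval) := {q | q.1 ∈ U ∧ |(q.2 : ℝ) - c| < 3 * ε}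
  have hW : IsOpen W := (hU.preimage continuous_fst).inter
    (isOpen_lt ((continuous_subtype_val.comp continuous_snd).sub continuous_const).abs
      continuous_const)
  have hWe : ∀ q ∈ W, q ∈ e.baseSet := fun q hq => hbox q.1 hq.1 q.2 hq.2
  have hWφ : ∀ q ∈ W, φ q ∈ e.baseSet := fun q hq => hbox q.1 hq.1 _ (hrbox q hq.2)
  -- Both branches are the identity where `lam = 0`, and `lam` vanishes near every point outside
  -- `W`; hence the gluing is smooth.
  let T : TotalSpace V E.Fiber → TotalSpace V E.Fiber := fun p =>
    if p.1 ∈ W then e.toOpenPartialHomeomorph.symm (φ p.1, (e p).2) else p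
  have hTfix : ∀ p : TotalSpace V E.Fiber, lam p.1 = 0 → T p = p := fun p hp => by
    by_cases hpW : p.1 ∈ W
    · have hps : p ∈ e.source := e.mem_source.2 (hWe _ hpW)
      simp only [T, if_pos hpW]
      rw [hfix _ hp, e.mk_proj_snd hps]
      exact e.toOpenPartialHomeomorph.left_inv hps
    · simp only [T, if_neg hpW]
  refine ⟨T, s, fun q => ?_, fun q => ?_, fun q hq1 hq2 => ?_, fun p hp => hTfix p ?_⟩
  · by_cases hq : q ∈ W
    · refine (isGMapAt_trivialization e hφ.contMDiffAt (hWe q hq) (hWφ q hq)).congr ?_ rfl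
      filter_upwards [hW.mem_nhds hq] with x hx v
      simp only [T, if_pos hx]
    · have hz : ∀ᶠ x in 𝓝 q, lam x = 0 := by
        by_cases hq1 : q.1 ∈ U
        · have hq2 : 2 * ε < |(q.2 : ℝ) - c| := by
            by_contra hcon
            exact hq ⟨hq1, by linarith⟩
          have : Continuous fun x : N × unitInterval => |(x.2 : ℝ) - c| :=
            ((continuous_subtype_val.comp continuous_snd).sub continuous_const).abs
          filter_upwards [this.continuousAt.eventually (lt_mem_nhds hq2)] with x hx
          simp only [lam, hβ0 _ (le_of_lt hx), mul_zero]
        · have hq2 : q.1 ∉ tsupport χ := fun hcon => hq1 (hχU hcon)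
          filter_upwards [continuous_fst.continuousAt.eventually
            ((isClosed_tsupport χ).isOpen_compl.mem_nhds hq2)] with x hx
          simp only [lam, image_eq_zero_of_notMem_tsupport hx, zero_mul]
      refine ((isGMap_id E) q).congr ?_ (hfix q hz.self_of_nhds)
      filter_upwards [hz] with x hx v
      exact hTfix _ hx
  · change (q.2 : ℝ) ≤ r q
    -- A point above `h` lies above `c + 2 * ε`, since heights never exceed `1`; there the bump
    -- vanishes, so nothing is lowered.
    have : 0 ≤ lam q * (h - q.2) := by
      rcases le_or_gt (q.2 : ℝ) h with h1 | h1
      · exact mul_nonneg (hlam0 q) (sub_nonneg.2 h1)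
      · have h2 : c + 2 * ε < q.2 := (min_lt_iff.1 h1).resolve_left (not_lt.2 q.2.2.2)
        have : lam q = 0 := by
          simp only [lam]
          rw [hβ0 _ ((by linarith : 2 * ε ≤ (q.2 : ℝ) - c).trans (le_abs_self _)), mul_zero]
        rw [this, zero_mul]
    simp only [r]
    linarith
  · change h ≤ r q
    have : lam q = 1 := by
      simp only [lam]
      rw [hq1, one_mul]
      exact β.one_of_mem_closedBall (by rwa [Metric.mem_closedBall, Real.dist_eq])
    simp [r, this]
  · simp only [lam, hp, zero_mul]

/-- Near every point of `N`, a `G`-bundle over `N × I` can be pushed up to height `1`. -/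
theorem exists_isPush (E : GBundle.{w} G (J.prod (𝓡∂ 1)) (N × unitInterval)) (x₀ : N) :
    ∃ U : Set N, IsOpen U ∧ x₀ ∈ U ∧ ∀ χ : N → ℝ, ContMDiff J 𝓘(ℝ, ℝ) ∞ χ →
      (∀ x, χ x ∈ Icc (0 : ℝ) 1) → tsupport χ ⊆ U → ∃ T s, IsPush E χ 1 T s := by
  -- The height `b` is made variable. `U` is chosen before `χ`, so two pushes can be composed with
  -- the same cutoff on an intersection of neighbourhoods.
  let P : ℝ → Prop := fun b => ∃ U : Set N, IsOpen U ∧ x₀ ∈ U ∧ ∀ χ : N → ℝ,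
    ContMDiff J 𝓘(ℝ, ℝ) ∞ χ → (∀ x, χ x ∈ Icc (0 : ℝ) 1) → tsupport χ ⊆ U →
      ∃ T s, IsPush E χ b T s
  change P 1
  have hP0 : P 0 := ⟨univ, isOpen_univ, mem_univ _, fun χ _ _ _ =>
    ⟨id, Prod.snd, isGMap_id E, fun _ => le_rfl, fun q _ => q.2.2.1, fun _ _ => rfl⟩⟩
  let S : Set ℝ := {b | b ∈ Icc (0 : ℝ) 1 ∧ P b}
  have h0S : (0 : ℝ) ∈ S := ⟨⟨le_rfl, zero_le_one⟩, hP0⟩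
  have hSbdd : BddAbove S := ⟨1, fun b hb => hb.1.2⟩
  set c := sSup S with hcdef
  have hc : c ∈ Icc (0 : ℝ) 1 := ⟨le_csSup hSbdd h0S, csSup_le ⟨0, h0S⟩ fun b hb => hb.1.2⟩
  let e := trivializationAt V E.Fiber (x₀, (⟨c, hc⟩ : unitInterval))
  have hmem : e.baseSet ∈ 𝓝 (x₀, (⟨c, hc⟩ : unitInterval)) :=
    e.open_baseSet.mem_nhds (mem_baseSet_trivializationAt V E.Fiber _)
  rw [nhds_prod_eq, mem_prod_iff] at hmem
  obtain ⟨U₁, hU₁, I₁, hI₁, hsub⟩ := hmem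
  obtain ⟨δ, hδ, hball⟩ := Metric.mem_nhds_iff.1 hI₁
  obtain ⟨U₂, hU₂, hU₂o, hx₂⟩ := mem_nhds_iff.1 hU₁
  have hε : 0 < δ / 3 := by linarith
  set ε := δ / 3 with hεdef
  have hδε : δ = 3 * ε := by rw [hεdef]; ring
  -- The supremum is not known to be attained, so the argument starts from an attained height within
  -- `ε` below it.
  obtain ⟨a, ⟨ha01, Ua, hUa, hxa, hPa⟩, hac⟩ :=
    exists_lt_of_lt_csSup ⟨0, h0S⟩ (by linarith : c - ε < sSup S)
  have hnext : P (min 1 (c + ε)) := by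
    refine ⟨Ua ∩ U₂, hUa.inter hU₂o, ⟨hxa, hx₂⟩, fun χ hχ hχ01 hχU => ?_⟩
    obtain ⟨T₁, s₁, H₁⟩ := hPa χ hχ hχ01 (hχU.trans inter_subset_left)
    obtain ⟨T₂, s₂, hT₂, hle₂, hht₂, hfix₂⟩ := exists_push_box e hU₂o hc hε
      (fun x hx t ht => hsub ⟨hU₂ hx, hball (by
        rw [Metric.mem_ball, Subtype.dist_eq, Real.dist_eq, hδε]; exact ht)⟩)
      hχ hχ01 (hχU.trans inter_subset_right)
    refine ⟨T₂ ∘ T₁, fun q => s₂ (q.1, s₁ q), hT₂.comp H₁.isGMap,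
      fun q => (H₁.le_apply q).trans (hle₂ (q.1, s₁ q)), fun q hq => ?_, fun p hp => ?_⟩
    -- After the first push the height exceeds `c - ε`. Either it is at most `c + ε`, and the box
    -- push raises it, or it already exceeds `c + ε`; both give only `min 1 (c + ε)`.
    · have h1 := H₁.height q hq
      rcases le_or_gt (s₁ q : ℝ) (c + ε) with h2 | h2
      · refine le_trans ?_ (hht₂ (q.1, s₁ q) hq (abs_le.2 ⟨?_, ?_⟩))
        · exact min_le_min_left _ (by linarith)
        · change -ε ≤ (s₁ q : ℝ) - c
          linarith
        · change (s₁ q : ℝ) - c ≤ ε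
          linarith
      · have h3 : (s₁ q : ℝ) ≤ s₂ (q.1, s₁ q) := hle₂ (q.1, s₁ q)
        exact (min_le_right _ _).trans (h2.le.trans h3)
    · rw [comp_apply, H₁.fixed p hp, hfix₂ p hp]
  have hnS : min 1 (c + ε) ∈ S :=
    ⟨⟨le_min zero_le_one (by linarith [hc.1]), min_le_left _ _⟩, hnext⟩
  have hle : min 1 (c + ε) ≤ c := le_csSup hSbdd hnS
  have h1 : (1 : ℝ) ≤ c + ε := by
    by_contra hcon
    rw [min_eq_right (not_le.1 hcon).le] at hle
    linarith
  rwa [min_eq_left h1] at hnext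

end Push

/-! ### Locally finite sequences of bump functions -/

section BumpFamily

variable {E : Type*} [NormedAddCommGroup E] [NormedSpace ℝ E] [FiniteDimensional ℝ E]
  {H : Type*} [TopologicalSpace H] (J : ModelWithCorners ℝ E H)
  {N : Type*} [TopologicalSpace N] [ChartedSpace H N] [IsManifold J ∞ N] [T2Space N]
  [SigmaCompactSpace N]

/-- A sequence of bump functions subordinate to a family of neighbourhoods of the points of a
closed set. -/
theorem exists_seq_bump {S : Set N} (hS : IsClosed S) {U : N → Set N} (hU : ∀ x ∈ S, U x ∈ 𝓝 x) :
    ∃ χ : ℕ → N → ℝ, (∀ k, ContMDiff J 𝓘(ℝ, ℝ) ∞ (χ k)) ∧ (∀ k x, χ k x ∈ Icc (0 : ℝ) 1) ∧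
      (∀ k, HasCompactSupport (χ k)) ∧ LocallyFinite (fun k => tsupport (χ k)) ∧
      (∀ k, χ k = 0 ∨ ∃ c ∈ S, tsupport (χ k) ⊆ U c) ∧
      (∀ x ∈ S, ∃ k, ∀ᶠ y in 𝓝 x, χ k y = 1) := by
  classical
  obtain ⟨ι, f, hf⟩ := SmoothBumpCovering.exists_isSubordinate J hS hU
  have hι : Countable ι := by
    have := f.locallyFinite.countable_univ fun i => (f i).nonempty_support
    exact countable_univ_iff.1 this
  obtain ⟨_⟩ := nonempty_encodable ι
  -- Integers that code no index get the zero function. With `decode₂` each index has a single code,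
  -- which preserves local finiteness.
  let χ : ℕ → N → ℝ := fun k => match Encodable.decode₂ ι k with
    | some i => f i
    | none => 0
  have hsome : ∀ k i, Encodable.decode₂ ι k = some i → χ k = f i := fun k i hk => by
    simp only [χ, hk]
  have hnone : ∀ k, Encodable.decode₂ ι k = none → χ k = 0 := fun k hk => by
    simp only [χ, hk]
  have hcases : ∀ k, χ k = 0 ∨ ∃ i, Encodable.decode₂ ι k = some i ∧ χ k = f i := fun k => by
    rcases hk : Encodable.decode₂ ι k with _ | i
    · exact Or.inl (hnone k hk)
    · exact Or.inr ⟨i, rfl, hsome k i hk⟩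
  refine ⟨χ, fun k => ?_, fun k x => ?_, fun k => ?_, ?_, fun k => ?_, fun x hx => ?_⟩
  · rcases hcases k with h | ⟨i, -, h⟩
    · rw [h]; exact contMDiff_const
    · rw [h]; exact (f i).contMDiff
  · rcases hcases k with h | ⟨i, -, h⟩
    · rw [h]; exact ⟨le_rfl, zero_le_one⟩
    · rw [h]; exact ⟨(f i).nonneg, (f i).le_one⟩
  · rcases hcases k with h | ⟨i, -, h⟩
    · rw [h]; exact HasCompactSupport.zero
    · rw [h]; exact (f i).hasCompactSupport
  · intro x
    obtain ⟨t, ht, hfin⟩ := f.locallyFinite.closure x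
    refine ⟨t, ht, (hfin.image Encodable.encode).subset ?_⟩
    rintro k ⟨y, hy, hyt⟩
    rcases hcases k with h | ⟨i, hi, h⟩
    · simp [h, tsupport] at hy
    · refine ⟨i, ⟨y, ?_, hyt⟩, Encodable.mem_decode₂.1 hi⟩
      simpa only [h] using! hy
  · rcases hcases k with h | ⟨i, -, h⟩
    · exact Or.inl h
    · exact Or.inr ⟨f.c i, f.c_mem' i, h ▸ hf i⟩
  · refine ⟨Encodable.encode (f.ind x hx), ?_⟩
    rw [hsome _ _ (Encodable.encodek₂ _)]
    exact f.eventuallyEq_one x hx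

end BumpFamily

end

noncomputable section

/-! ### Pullbacks along compositions, identities and constants -/

section PullbackIso

variable {V : Type*} [NormedAddCommGroup V] [NormedSpace ℝ V]
  {G : Subgroup (V ≃L[ℝ] V)}
  {EB : Type*} [NormedAddCommGroup EB] [NormedSpace ℝ EB]
  {HB : Type*} [TopologicalSpace HB] {J : ModelWithCorners ℝ EB HB}
  {B : Type*} [TopologicalSpace B] [ChartedSpace HB B]
  {EC : Type*} [NormedAddCommGroup EC] [NormedSpace ℝ EC]
  {HC : Type*} [TopologicalSpace HC] {K : ModelWithCorners ℝ EC HC}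
  {C : Type*} [TopologicalSpace C] [ChartedSpace HC C]
  {ED : Type*} [NormedAddCommGroup ED] [NormedSpace ℝ ED]
  {HD : Type*} [TopologicalSpace HD] {L : ModelWithCorners ℝ ED HD}
  {D : Type*} [TopologicalSpace D] [ChartedSpace HD D]

/-- Pulling back along a composition is pulling back twice. -/
def GIso.pullbackComp (f : C^∞⟮K, C; J, B⟯) (g : C^∞⟮L, D; K, C⟯) (E : GBundle.{w} G J B) :
    GIso (E.pullback (f.comp g)) ((E.pullback f).pullback g) where
  equiv d := LinearEquiv.refl ℝ (E.Fiber (f (g d)))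
  contMDiff_equiv := GBundle.contMDiff_pullback g (E.pullback f) (contMDiff_proj _)
    (GBundle.contMDiff_pullback f E (g.contMDiff.comp (contMDiff_proj _))
      (GBundle.contMDiff_lift (f.comp g) E))
  contMDiff_symm := GBundle.contMDiff_pullback (f.comp g) E (contMDiff_proj _)
    ((GBundle.contMDiff_lift f E).comp (GBundle.contMDiff_lift g (E.pullback f)))
  equiv_mem := by
    rintro _ _ ⟨e, he, rfl⟩ ⟨_, ⟨e', he', rfl⟩, rfl⟩ d hd hd'
    exact E.transition_mem e e' (f (g d)) hd hd'

/-- Pulling back along the identity changes nothing. -/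
def GIso.pullbackId (E : GBundle.{w} G J B) :
    GIso (E.pullback (ContMDiffMap.id : C^∞⟮J, B; J, B⟯)) E where
  equiv b := LinearEquiv.refl ℝ (E.Fiber b)
  contMDiff_equiv := GBundle.contMDiff_lift ContMDiffMap.id E
  contMDiff_symm := GBundle.contMDiff_pullback ContMDiffMap.id E (contMDiff_proj _) contMDiff_id
  equiv_mem := by
    rintro _ e' ⟨e, he, rfl⟩ he' b hb hb'
    exact E.transition_mem e e' b hb hb'

/-- A pullback along a constant map is trivial. -/
theorem GIso.nonempty_pullbackConst [FiniteDimensional ℝ V] (b₀ : B) (E : GBundle.{w} G J B) :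
    Nonempty (GIso (E.pullback (ContMDiffMap.const b₀ : C^∞⟮K, C; J, B⟯))
      (GBundle.trivial G K C)) := by
  let e := trivializationAt V E.Fiber b₀
  have hb : b₀ ∈ e.baseSet := mem_baseSet_trivializationAt V E.Fiber b₀
  let f : C^∞⟮K, C; J, B⟯ := ContMDiffMap.const b₀
  let φ : ∀ c, (E.pullback f).Fiber c ≃ₗ[ℝ] (GBundle.trivial G K C).Fiber c :=
    fun c => e.linearEquivAt ℝ b₀ hb
  have hsm : ContMDiff (K.prod 𝓘(ℝ, V)) (K.prod 𝓘(ℝ, V)) ∞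
      (fun p : TotalSpace V (E.pullback f).Fiber =>
        (⟨p.1, φ p.1 p.2⟩ : TotalSpace V (GBundle.trivial G K C).Fiber)) := by
    intro p
    rw [contMDiffAt_totalSpace]
    refine ⟨contMDiffAt_proj _, ?_⟩
    have h := GBundle.contMDiff_lift f E p
    exact ((e.contMDiffAt_iff (by rw [e.mem_source]; exact hb)).1 h).2
  have hmem : ∀ (e₁ : Trivialization V (π V (E.pullback f).Fiber))
      (e' : Trivialization V (π V (GBundle.trivial G K C).Fiber))
      [MemTrivializationAtlas e₁] [MemTrivializationAtlas e'] (c : C),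
      c ∈ e₁.baseSet → c ∈ e'.baseSet →
        ∃ g ∈ G, ∀ v : (E.pullback f).Fiber c,
          (e' (⟨c, φ c v⟩ : TotalSpace V (GBundle.trivial G K C).Fiber)).2 = g (e₁ ⟨c, v⟩).2 := by
    rintro _ e' ⟨e₁, he₁, rfl⟩ he' c hc hc'
    have h' : e' = Bundle.Trivial.trivialization C V := @Bundle.Trivial.eq_trivialization C V _ _ e' he'
    subst h'
    exact E.transition_mem e₁ e b₀ hc hb
  exact ⟨⟨φ, hsm, contMDiff_symm_of_mem φ hsm hmem, hmem⟩⟩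

end PullbackIso

/-! ### Bundles over the cylinder -/

section Cylinder

variable {V : Type*} [NormedAddCommGroup V] [NormedSpace ℝ V]
  {G : Subgroup (V ≃L[ℝ] V)}
  {EN : Type*} [NormedAddCommGroup EN] [NormedSpace ℝ EN]
  {HN : Type*} [TopologicalSpace HN] {J : ModelWithCorners ℝ EN HN}
  {N : Type*} [TopologicalSpace N] [ChartedSpace HN N]

variable (J N) in
/-- The inclusion of `N` into `N × I` at height `t`. -/
def ContMDiffMap.slice (t : unitInterval) :
    C^∞⟮J, N; J.prod (𝓡∂ 1), N × unitInterval⟯ :=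
  ⟨fun x => (x, t), contMDiff_id.prodMk contMDiff_const⟩

/-- Iterated composition of a sequence of self-maps. -/
def iterComp {X : Type*} (T : ℕ → X → X) : ℕ → X → X
  | 0 => id
  | k + 1 => T k ∘ iterComp T k

/-- Apply one push for each bump function, in sequence. By local finiteness the compositions
stabilize near each point. Every `x` has some `χ k = 1`, which brings its whole fibre of heights to
`1`, and later pushes never lower it. -/
theorem exists_isGMap_slice_one [FiniteDimensional ℝ EN] [IsManifold J ∞ N] [T2Space N]
    [SigmaCompactSpace N] (E : GBundle.{w} G (J.prod (𝓡∂ 1)) (N × unitInterval)) :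
    ∃ F : TotalSpace V E.Fiber → TotalSpace V E.Fiber, IsGMap E E F (fun q => (q.1, 1)) := by
  choose U hUo hxU hpush using exists_isPush E
  obtain ⟨χ, hχ, hχ01, -, hlf, hsub, hone⟩ := exists_seq_bump J (S := (univ : Set N))
    isClosed_univ (U := U) (fun x _ => (hUo x).mem_nhds (hxU x))
  have hT : ∀ k, ∃ T s, IsPush E (χ k) 1 T s := fun k => by
    rcases hsub k with h | ⟨c, -, h⟩
    -- For a zero bump function the identity is a push: the height condition is vacuous.
    · exact ⟨id, Prod.snd, isGMap_id E, fun _ => le_rfl,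
        fun q hq => by rw [h] at hq; simp at hq, fun _ _ => rfl⟩
    · exact hpush c (χ k) (hχ k) (hχ01 k) h
  choose T s hTs using hT
  let Φ : ℕ → N × unitInterval → N × unitInterval := iterComp fun k q => (q.1, s k q)
  let F : ℕ → TotalSpace V E.Fiber → TotalSpace V E.Fiber := iterComp T
  have hF : ∀ k, IsGMap E E (F k) (Φ k) := by
    intro k
    induction k with
    | zero => exact isGMap_id E
    | succ k ih => exact (hTs k).isGMap.comp ih
  have hfst : ∀ k q, (Φ k q).1 = q.1 := by
    intro k
    induction k with
    | zero => exact fun _ => rfl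
    | succ k ih => exact fun q => ih q
  have hstay : ∀ k q, (Φ k q).2 = 1 → (Φ (k + 1) q).2 = 1 := fun k q h =>
    le_antisymm unitInterval.le_one' (h ▸ (hTs k).le_apply (Φ k q))
  have htop : ∀ k q, χ k q.1 = 1 → ∀ m, k < m → (Φ m q).2 = 1 := by
    intro k q hq m hm
    induction m, hm using Nat.le_induction with
    | base =>
      refine le_antisymm unitInterval.le_one' ?_
      exact (hTs k).height (Φ k q) (by rw [hfst]; exact hq)
    | succ m _ ih => exact hstay m q ih
  -- Regarded as functions of the base point, the maps stabilize over open sets of the base, on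
  -- entire fibres at once.
  let f : ℕ → ∀ q, E.Fiber q → TotalSpace V E.Fiber := fun k q v => F k ⟨q, v⟩
  have hfl : LocallyFinite fun k => {q | f (k + 1) q ≠ f k q} := by
    refine (hlf.preimage_continuous continuous_fst).subset fun k q hq => ?_
    by_contra hcon
    refine hq (funext fun v => (hTs k).fixed _ ?_)
    rw [(hF k q).proj, hfst]
    exact image_eq_zero_of_notMem_tsupport hcon
  obtain ⟨F', hF'⟩ := hfl.exists_forall_eventually_atTop_eventually_eq'
  refine ⟨fun p => F' p.1 p.2, fun q => ?_⟩
  obtain ⟨k, hk⟩ := hone q.1 (mem_univ _)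
  obtain ⟨m, hm, hkm⟩ := ((hF' q).and (eventually_gt_atTop k)).exists
  refine (hF m q).congr ?_ (Prod.ext (hfst m q).symm (htop k q hk.self_of_nhds m hkm).symm)
  filter_upwards [hm] with y hy v
  rw [← hy]

/-- A `G`-bundle over `N × I` is the pullback of its restriction to the top. -/
theorem GBundle.nonempty_gIso_pullback_fst [FiniteDimensional ℝ V] [FiniteDimensional ℝ EN]
    [IsManifold J ∞ N] [T2Space N] [SigmaCompactSpace N]
    (E : GBundle.{w} G (J.prod (𝓡∂ 1)) (N × unitInterval)) :
    Nonempty (GIso E ((E.pullback (ContMDiffMap.slice J N 1)).pullback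
      (ContMDiffMap.fst : C^∞⟮J.prod (𝓡∂ 1), N × unitInterval; J, N⟯))) := by
  obtain ⟨F, hF⟩ := exists_isGMap_slice_one E
  obtain ⟨φ⟩ := IsGMap.nonempty_gIso
    (f := (ContMDiffMap.slice J N 1).comp ContMDiffMap.fst) hF
  exact ⟨φ.trans (GIso.pullbackComp _ _ E)⟩

/-- The restrictions of a `G`-bundle over `N × I` to two slices are isomorphic. -/
theorem GBundle.nonempty_gIso_slice [FiniteDimensional ℝ V] [FiniteDimensional ℝ EN]
    [IsManifold J ∞ N] [T2Space N] [SigmaCompactSpace N]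
    (E : GBundle.{w} G (J.prod (𝓡∂ 1)) (N × unitInterval)) (t₀ t₁ : unitInterval) :
    Nonempty (GIso (E.pullback (ContMDiffMap.slice J N t₀))
      (E.pullback (ContMDiffMap.slice J N t₁))) := by
  obtain ⟨φ⟩ := E.nonempty_gIso_pullback_fst
  -- The projection after any slice is the identity of `N`, so every restriction is isomorphic to
  -- the top one.
  have key : ∀ t, Nonempty (GIso (E.pullback (ContMDiffMap.slice J N t))
      (E.pullback (ContMDiffMap.slice J N 1))) := fun t =>
    ⟨(φ.pullback (ContMDiffMap.slice J N t)).trans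
      ((GIso.pullbackComp ContMDiffMap.fst (ContMDiffMap.slice J N t) _).symm.trans
        (GIso.pullbackId (E.pullback (ContMDiffMap.slice J N 1))))⟩
  obtain ⟨φ₀⟩ := key t₀
  obtain ⟨φ₁⟩ := key t₁
  exact ⟨φ₀.trans φ₁.symm⟩

end Cylinder

end

noncomputable section

/-! ### Smoothing continuous maps relative to a closed set -/

section Smoothing

variable {EW : Type*} [NormedAddCommGroup EW] [NormedSpace ℝ EW] [FiniteDimensional ℝ EW]
  {HW : Type*} [TopologicalSpace HW] {J : ModelWithCorners ℝ EW HW}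
  {W : Type*} [TopologicalSpace W] [ChartedSpace HW W] [IsManifold J ∞ W] [T2Space W]
  [SigmaCompactSpace W]
  {EM : Type*} [NormedAddCommGroup EM] [NormedSpace ℝ EM]
  {M : Type*} [TopologicalSpace M] [ChartedSpace EM M] [IsManifold 𝓘(ℝ, EM) ∞ M]

/-- A continuous map into a chart domain can be smoothed where a bump function equals `1`, keeping
open conditions prescribed on a locally finite family of closed sets. -/
theorem exists_smoothing_step {ι : Type*} {h : W → M} (hh : Continuous h) {lam : W → ℝ}
    (hlam : ContMDiff J 𝓘(ℝ, ℝ) ∞ lam) (hlam01 : ∀ x, lam x ∈ Icc (0 : ℝ) 1)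
    (hcpt : HasCompactSupport lam) (d : M)
    (hd : ∀ x ∈ tsupport lam, h x ∈ (chartAt EM d).source)
    {A : ι → Set W} (hA : LocallyFinite A) (hAc : ∀ j, IsClosed (A j)) {D : ι → Set M}
    (hDo : ∀ j, IsOpen (D j)) (hAD : ∀ j, ∀ x ∈ A j, h x ∈ D j) :
    ∃ h' : W → M, Continuous h' ∧ (∀ x, x ∉ tsupport lam → h' x = h x) ∧
      (∀ j, ∀ x ∈ A j, h' x ∈ D j) ∧
      (∀ x, ContMDiffAt J 𝓘(ℝ, EM) ∞ h x → ContMDiffAt J 𝓘(ℝ, EM) ∞ h' x) ∧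
      (∀ x, (∀ᶠ y in 𝓝 x, lam y = 1) → ContMDiffAt J 𝓘(ℝ, EM) ∞ h' x) := by
  classical
  let ψ := chartAt EM d
  let u : W → EM := fun x => ψ (h x)
  set Y : Set W := h ⁻¹' ψ.source with hY
  have hYo : IsOpen Y := ψ.open_source.preimage hh
  have hLY : tsupport lam ⊆ Y := hd
  have hu : ∀ x ∈ Y, ContinuousAt u x := fun x hx =>
    (ψ.continuousAt hx).comp hh.continuousAt
  -- Compactness of the support gives one tolerance: any perturbation of `u` below `ε` stays in the
  -- chart and respects all the conditions `D j`.
  obtain ⟨ε, hε, hball⟩ : ∃ ε > (0 : ℝ), ∀ x ∈ tsupport lam, ∀ z ∈ Metric.ball (u x) ε,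
      z ∈ ψ.target ∧ ∀ j, x ∈ A j → ψ.symm z ∈ D j := by
    refine IsCompact.induction_on (p := fun s => ∃ ε > (0 : ℝ), ∀ x ∈ s,
      ∀ z ∈ Metric.ball (u x) ε, z ∈ ψ.target ∧ ∀ j, x ∈ A j → ψ.symm z ∈ D j) hcpt
      ⟨1, one_pos, fun x hx => absurd hx (notMem_empty x)⟩ ?_ ?_ ?_
    · rintro s t hst ⟨ε, hε, H⟩
      exact ⟨ε, hε, fun x hx => H x (hst hx)⟩
    · rintro s t ⟨ε, hε, H⟩ ⟨δ, hδ, H'⟩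
      refine ⟨min ε δ, lt_min hε hδ, fun x hx z hz => ?_⟩
      rcases hx with hx | hx
      · exact H x hx z (Metric.ball_subset_ball (min_le_left _ _) hz)
      · exact H' x hx z (Metric.ball_subset_ball (min_le_right _ _) hz)
    · intro x hx
      have hxY : h x ∈ ψ.source := hd x hx
      have hfin : {j | x ∈ A j}.Finite := hA.point_finite x
      let Z : Set EM := ψ.target ∩ ψ.symm ⁻¹' ⋂ j ∈ {j | x ∈ A j}, D j
      have hZ : IsOpen Z := ψ.isOpen_inter_preimage_symm (hfin.isOpen_biInter fun j _ => hDo j)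
      have huZ : u x ∈ Z := by
        refine ⟨ψ.map_source hxY, ?_⟩
        rw [mem_preimage, ψ.left_inv hxY]
        exact mem_iInter₂.2 fun j hj => hAD j x hj
      obtain ⟨δ, hδ, hδZ⟩ := Metric.isOpen_iff.1 hZ (u x) huZ
      have h1 : ∀ᶠ y in 𝓝 x, dist (u y) (u x) < δ / 2 :=
        (hu x (hLY hx)).eventually (Metric.ball_mem_nhds _ (half_pos hδ))
      -- Near `x` only those `A j` that contain `x` can occur, so finitely many conditions matter.
      have h2 := hA.iInter_compl_mem_nhds hAc x
      refine ⟨_, mem_nhdsWithin_of_mem_nhds (inter_mem h1 h2), δ / 2, half_pos hδ, ?_⟩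
      rintro y ⟨hy1, hy2⟩ z hz
      have hzZ : z ∈ Z := hδZ <| by
        rw [Metric.mem_ball] at hz ⊢
        have : dist (u y) (u x) < δ / 2 := hy1
        linarith [dist_triangle z (u y) (u x)]
      refine ⟨hzZ.1, fun j hj => ?_⟩
      have hxj : x ∈ A j := by
        by_contra hcon
        exact (mem_iInter₂.1 hy2 j hcon) hj
      exact mem_iInter₂.1 hzZ.2 j hxj
  obtain ⟨g, hg⟩ : ∃ g : C^∞⟮J, W; 𝓘(ℝ, EM), EM⟯,
      ∀ x, g x ∈ {y | x ∈ tsupport lam → y ∈ Metric.ball (u x) ε} := by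
    refine exists_contMDiffMap_forall_mem_convex_of_local_const J (n := ⊤) (fun x => ?_)
      fun x => ?_
    · by_cases hx : x ∈ tsupport lam
      · simpa only [hx, true_imp_iff] using! convex_ball (u x) ε
      · simpa only [hx, false_imp_iff] using! convex_univ
    · by_cases hx : x ∈ tsupport lam
      · refine ⟨u x, ?_⟩
        filter_upwards [(hu x (hLY hx)).eventually (Metric.ball_mem_nhds _ hε)] with y hy _
        exact Metric.mem_ball_comm.1 hy
      · refine ⟨0, ?_⟩
        filter_upwards [(isClosed_tsupport lam).isOpen_compl.mem_nhds hx] with y hy hy'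
        exact absurd hy' hy
  -- Interpolates in the chart from `u` where `lam = 0` to the smooth approximation `g` where `lam =
  -- 1`; it is smooth wherever `u` already was.
  let v : W → EM := fun x => u x + lam x • (g x - u x)
  have hvball : ∀ x ∈ tsupport lam, v x ∈ Metric.ball (u x) ε := fun x hx => by
    have hgx := hg x hx
    rw [Metric.mem_ball, dist_eq_norm] at hgx ⊢
    have : v x - u x = lam x • (g x - u x) := by simp [v]
    rw [this, norm_smul, Real.norm_of_nonneg (hlam01 x).1]
    exact (mul_le_of_le_one_left (norm_nonneg _) (hlam01 x).2).trans_lt hgx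
  have hvu : ∀ x, x ∉ tsupport lam → v x = u x := fun x hx => by
    simp [v, image_eq_zero_of_notMem_tsupport hx]
  have hvt : ∀ x ∈ Y, v x ∈ ψ.target := fun x hx => by
    by_cases hxL : x ∈ tsupport lam
    · exact (hball x hxL _ (hvball x hxL)).1
    · rw [hvu x hxL]
      exact ψ.map_source hx
  let h' : W → M := fun x => if x ∈ tsupport lam then ψ.symm (v x) else h x
  have hout : ∀ x, x ∉ tsupport lam → h' x = h x := fun x hx => if_neg hx
  have hin : ∀ x ∈ Y, h' x = ψ.symm (v x) := fun x hx => by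
    by_cases hxL : x ∈ tsupport lam
    · exact if_pos hxL
    · rw [hout x hxL, hvu x hxL]
      exact (ψ.left_inv hx).symm
  have hnin : ∀ x ∈ Y, h' =ᶠ[𝓝 x] ψ.symm ∘ v := fun x hx => by
    filter_upwards [hYo.mem_nhds hx] with y hy using hin y hy
  have hnout : ∀ x, x ∉ tsupport lam → h' =ᶠ[𝓝 x] h := fun x hx => by
    filter_upwards [(isClosed_tsupport lam).isOpen_compl.mem_nhds hx] with y hy using hout y hy
  have hsymm : ∀ x ∈ Y, ContMDiffAt J 𝓘(ℝ, EM) ∞ v x → ContMDiffAt J 𝓘(ℝ, EM) ∞ h' x :=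
    fun x hx hv => by
      have h1 : ContMDiffAt 𝓘(ℝ, EM) 𝓘(ℝ, EM) ∞ ψ.symm (v x) :=
        contMDiffOn_chart_symm.contMDiffAt (ψ.open_target.mem_nhds (hvt x hx))
      exact (h1.comp x hv).congr_of_eventuallyEq (hnin x hx)
  refine ⟨h', continuous_iff_continuousAt.2 fun x => ?_, hout, fun j x hx => ?_, fun x hx => ?_,
    fun x hx => ?_⟩
  · by_cases hxL : x ∈ tsupport lam
    · have hxY := hLY hxL
      have hvc : ContinuousAt v x := (hu x hxY).add
        (hlam.continuous.continuousAt.smul (g.contMDiff.continuous.continuousAt.sub (hu x hxY)))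
      exact ((ψ.continuousAt_symm (hvt x hxY)).comp hvc).congr (hnin x hxY).symm
    · exact hh.continuousAt.congr (hnout x hxL).symm
  · by_cases hxL : x ∈ tsupport lam
    · rw [hin x (hLY hxL)]
      exact (hball x hxL _ (hvball x hxL)).2 j hx
    · rw [hout x hxL]
      exact hAD j x hx
  · by_cases hxL : x ∈ tsupport lam
    · have hxY := hLY hxL
      have h1 : ContMDiffAt 𝓘(ℝ, EM) 𝓘(ℝ, EM) ∞ ψ (h x) :=
        contMDiffOn_chart.contMDiffAt (ψ.open_source.mem_nhds hxY)
      have h2 : ContMDiffAt J 𝓘(ℝ, EM) ∞ u x := h1.comp x hx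
      exact hsymm x hxY (h2.add (hlam.contMDiffAt.smul (g.contMDiff.contMDiffAt.sub h2)))
    · exact hx.congr_of_eventuallyEq (hnout x hxL)
  · have hxL : x ∈ tsupport lam := subset_tsupport lam (by
      rw [mem_support, hx.self_of_nhds]; exact one_ne_zero)
    refine hsymm x (hLY hxL) (g.contMDiff.contMDiffAt.congr_of_eventuallyEq ?_)
    filter_upwards [hx] with y hy
    simp [v, hy]

/-- A continuous map of manifolds that is smooth on a neighbourhood `O` of a closed set `A`
can be replaced by a smooth map that agrees with it on `A`. -/
theorem exists_contMDiffMap_eqOn {h : W → M} (hh : Continuous h) {A O : Set W} (hA : IsClosed A)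
    (hO : IsOpen O) (hAO : A ⊆ O) (hsm : ∀ x ∈ O, ContMDiffAt J 𝓘(ℝ, EM) ∞ h x) :
    ∃ h' : C^∞⟮J, W; 𝓘(ℝ, EM), M⟯, EqOn h' h A := by
  rcases isEmpty_or_nonempty W with hW | ⟨⟨x₀⟩⟩
  · exact ⟨⟨h, fun x => isEmptyElim x⟩, fun _ _ => rfl⟩
  obtain ⟨χ, hχ, hχ01, hcpt, hlf, hsub, hone⟩ := exists_seq_bump J hO.isClosed_compl
    (U := fun c => Aᶜ ∩ h ⁻¹' (chartAt EM (h c)).source) (fun x hx =>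
      (hA.isOpen_compl.inter ((chartAt EM (h x)).open_source.preimage hh)).mem_nhds
        ⟨fun hxA => hx (hAO hxA), mem_chart_source EM (h x)⟩)
  have hchart : ∀ k, ∃ d : M, tsupport (χ k) ⊆ Aᶜ ∩ h ⁻¹' (chartAt EM d).source := fun k => by
    rcases hsub k with h0 | ⟨c, -, hc⟩
    · refine ⟨h x₀, ?_⟩
      rw [h0, tsupport, support_zero, closure_empty]
      exact empty_subset _
    · exact ⟨h c, hc⟩
  choose d hd using hchart
  -- The invariant covers all indices, including those not yet treated: each step must leave the
  -- later charts usable.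
  let X := {f : W → M // Continuous f ∧ ∀ k, ∀ x ∈ tsupport (χ k), f x ∈ (chartAt EM (d k)).source}
  have hstep : ∀ (k : ℕ) (f : X), ∃ f' : X, (∀ x, x ∉ tsupport (χ k) → f'.1 x = f.1 x) ∧
      (∀ x, ContMDiffAt J 𝓘(ℝ, EM) ∞ f.1 x → ContMDiffAt J 𝓘(ℝ, EM) ∞ f'.1 x) ∧
      (∀ x, (∀ᶠ y in 𝓝 x, χ k y = 1) → ContMDiffAt J 𝓘(ℝ, EM) ∞ f'.1 x) := fun k f => by
    obtain ⟨f', h1, h2, h3, h4, h5⟩ := exists_smoothing_step f.2.1 (hχ k) (hχ01 k) (hcpt k) (d k)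
      (f.2.2 k) hlf (fun j => isClosed_tsupport _) (fun j => (chartAt EM (d j)).open_source) f.2.2
    exact ⟨⟨f', h1, h3⟩, h2, h4, h5⟩
  choose step hoff hkeep hnew using hstep
  let f₀ : X := ⟨h, hh, fun k x hx => (hd k hx).2⟩
  let f : ℕ → X := fun k => Nat.rec f₀ step k
  have hfA : ∀ k, ∀ x ∈ A, (f k).1 x = h x := fun k x hx => by
    induction k with
    | zero => rfl
    | succ k ih => exact (hoff k (f k) x fun hcon => (hd k hcon).1 hx).trans ih
  have hmono : ∀ k m x, k ≤ m → ContMDiffAt J 𝓘(ℝ, EM) ∞ (f k).1 x →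
      ContMDiffAt J 𝓘(ℝ, EM) ∞ (f m).1 x := fun k m x hkm hx => by
    induction m, hkm using Nat.le_induction with
    | base => exact hx
    | succ m _ ih => exact hkeep m (f m) x ih
  have hfl : LocallyFinite fun k => {x | (f (k + 1)).1 x ≠ (f k).1 x} := by
    refine hlf.subset fun k x hx => ?_
    by_contra hcon
    exact hx (hoff k (f k) x hcon)
  obtain ⟨F, hF⟩ := hfl.exists_forall_eventually_atTop_eventuallyEq (f := fun k => (f k).1)
  refine ⟨⟨F, fun x => ?_⟩, fun x hx => ?_⟩
  -- On `O` smoothness holds from the start; elsewhere it appears at the step whose bump function is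
  -- `1` near `x`. It is never lost afterwards.
  · have hev : ∃ k, ContMDiffAt J 𝓘(ℝ, EM) ∞ (f k).1 x := by
      by_cases hx : x ∈ O
      · exact ⟨0, hsm x hx⟩
      · obtain ⟨k, hk⟩ := hone x hx
        exact ⟨k + 1, hnew k (f k) x hk⟩
    obtain ⟨k, hk⟩ := hev
    obtain ⟨m, hm, hkm⟩ := ((hF x).and (eventually_ge_atTop k)).exists
    exact (hmono k m x hkm hk).congr_of_eventuallyEq hm.symm
  · obtain ⟨m, hm⟩ := (hF x).exists
    exact hm.eq_of_nhds.symm.trans (hfA m x hx)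

end Smoothing

end

noncomputable section

/-! ### Homotopic maps and contractible bases -/

section Homotopy

variable {EN : Type*} [NormedAddCommGroup EN] [NormedSpace ℝ EN] [FiniteDimensional ℝ EN]
  {HN : Type*} [TopologicalSpace HN] {J : ModelWithCorners ℝ EN HN}
  {N : Type*} [TopologicalSpace N] [ChartedSpace HN N] [IsManifold J ∞ N] [T2Space N]
  [SigmaCompactSpace N]
  {EM : Type*} [NormedAddCommGroup EM] [NormedSpace ℝ EM]
  {M : Type*} [TopologicalSpace M] [ChartedSpace EM M] [IsManifold 𝓘(ℝ, EM) ∞ M]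

/-- Smooth maps that are continuously homotopic are smoothly homotopic. -/
theorem exists_smooth_homotopy {f₀ f₁ : C^∞⟮J, N; 𝓘(ℝ, EM), M⟯}
    (h : ContinuousMap.Homotopic (f₀ : C(N, M)) (f₁ : C(N, M))) :
    ∃ F : C^∞⟮J.prod (𝓡∂ 1), N × unitInterval; 𝓘(ℝ, EM), M⟯,
      F.comp (ContMDiffMap.slice J N 0) = f₀ ∧ F.comp (ContMDiffMap.slice J N 1) = f₁ := by
  obtain ⟨H⟩ := h
  -- The time change makes the homotopy stationary on `[0, 1/3]` and `[2/3, 1]`, hence smooth near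
  -- both ends.
  let σ : ℝ → ℝ := fun t => Real.smoothTransition (3 * t - 1)
  have hσc : Continuous σ := Real.smoothTransition.continuous.comp (by fun_prop)
  let σ' : ℝ → unitInterval := fun t =>
    ⟨σ t, Real.smoothTransition.nonneg _, Real.smoothTransition.le_one _⟩
  have hσ0 : ∀ t : ℝ, t ≤ 1 / 3 → σ' t = 0 := fun t ht =>
    Subtype.ext (Real.smoothTransition.zero_of_nonpos (by linarith))
  have hσ1 : ∀ t : ℝ, 2 / 3 ≤ t → σ' t = 1 := fun t ht =>
    Subtype.ext (Real.smoothTransition.one_of_one_le (by linarith))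
  let k : N × unitInterval → M := fun q => H (σ' q.2, q.1)
  have hval : Continuous fun q : N × unitInterval => (q.2 : ℝ) :=
    continuous_subtype_val.comp continuous_snd
  have hk : Continuous k :=
    H.continuous.comp (((hσc.comp hval).subtype_mk _).prodMk continuous_fst)
  have hk0 : ∀ q : N × unitInterval, (q.2 : ℝ) ≤ 1 / 3 → k q = f₀ q.1 := fun q hq => by
    simp only [k]
    rw [hσ0 _ hq]
    exact H.apply_zero q.1
  have hk1 : ∀ q : N × unitInterval, 2 / 3 ≤ (q.2 : ℝ) → k q = f₁ q.1 := fun q hq => by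
    simp only [k]
    rw [hσ1 _ hq]
    exact H.apply_one q.1
  let A : Set (N × unitInterval) := {q | (q.2 : ℝ) ≤ 0} ∪ {q | 1 ≤ (q.2 : ℝ)}
  let O : Set (N × unitInterval) := {q | (q.2 : ℝ) < 1 / 3} ∪ {q | 2 / 3 < (q.2 : ℝ)}
  have hO0 : IsOpen {q : N × unitInterval | (q.2 : ℝ) < 1 / 3} := isOpen_lt hval continuous_const
  have hO1 : IsOpen {q : N × unitInterval | 2 / 3 < (q.2 : ℝ)} := isOpen_lt continuous_const hval
  obtain ⟨F, hF⟩ := exists_contMDiffMap_eqOn (J := J.prod (𝓡∂ 1)) (A := A) (O := O) hk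
    ((isClosed_le hval continuous_const).union (isClosed_le continuous_const hval))
    (hO0.union hO1) (by
      rintro q (hq | hq)
      · left
        rw [mem_ofPred_eq] at hq ⊢
        linarith
      · right
        rw [mem_ofPred_eq] at hq ⊢
        linarith) (by
      rintro q (hq | hq)
      · refine (f₀.contMDiff.comp contMDiff_fst).contMDiffAt.congr_of_eventuallyEq ?_
        filter_upwards [hO0.mem_nhds hq] with p hp using hk0 p (le_of_lt hp)
      · refine (f₁.contMDiff.comp contMDiff_fst).contMDiffAt.congr_of_eventuallyEq ?_
        filter_upwards [hO1.mem_nhds hq] with p hp using hk1 p (le_of_lt hp))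
  refine ⟨F, ContMDiffMap.ext fun x => ?_, ContMDiffMap.ext fun x => ?_⟩
  · exact (hF (x := (x, 0)) (Or.inl (le_refl (0 : ℝ)))).trans (hk0 (x, 0) (by norm_num))
  · exact (hF (x := (x, 1)) (Or.inr (le_refl (1 : ℝ)))).trans (hk1 (x, 1) (by norm_num))

variable {V : Type*} [NormedAddCommGroup V] [NormedSpace ℝ V] [FiniteDimensional ℝ V]
  {G : Subgroup (V ≃L[ℝ] V)}

/-- Pullbacks of a `G`-bundle along homotopic smooth maps are isomorphic. -/
theorem GBundle.nonempty_gIso_of_homotopic (E : GBundle.{w} G 𝓘(ℝ, EM) M)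
    {f₀ f₁ : C^∞⟮J, N; 𝓘(ℝ, EM), M⟯}
    (h : ContinuousMap.Homotopic (f₀ : C(N, M)) (f₁ : C(N, M))) :
    Nonempty (GIso (E.pullback f₀) (E.pullback f₁)) := by
  obtain ⟨F, rfl, rfl⟩ := exists_smooth_homotopy h
  obtain ⟨φ⟩ := (E.pullback F).nonempty_gIso_slice (0 : unitInterval) 1
  exact ⟨(GIso.pullbackComp F _ E).trans (φ.trans (GIso.pullbackComp F _ E).symm)⟩

/-- A `G`-bundle over a contractible manifold is trivial. -/
theorem GBundle.nonempty_gIso_trivial [FiniteDimensional ℝ EM] [T2Space M] [SigmaCompactSpace M]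
    [ContractibleSpace M] (E : GBundle.{w} G 𝓘(ℝ, EM) M) :
    Nonempty (GIso E (GBundle.trivial G 𝓘(ℝ, EM) M)) := by
  obtain ⟨y, hy⟩ := id_nullhomotopic M
  obtain ⟨φ⟩ := E.nonempty_gIso_of_homotopic
    (f₀ := (ContMDiffMap.id : C^∞⟮𝓘(ℝ, EM), M; 𝓘(ℝ, EM), M⟯))
    (f₁ := ContMDiffMap.const y) hy
  obtain ⟨ψ⟩ := GIso.nonempty_pullbackConst (K := 𝓘(ℝ, EM)) (C := M) y E
  exact ⟨(GIso.pullbackId E).symm.trans (φ.trans ψ)⟩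

end Homotopy

end

theorem mainTheorem4
    {V : Type*} [NormedAddCommGroup V] [NormedSpace ℝ V] [FiniteDimensional ℝ V]
    (G : Subgroup (V ≃L[ℝ] V))
    {n : ℕ} {N : Type*} [TopologicalSpace N] [T2Space N] [SecondCountableTopology N]
    [ChartedSpace (EuclideanSpace ℝ (Fin n)) N] [IsManifold (𝓡 n) ∞ N]
    {m : ℕ} {M : Type*} [TopologicalSpace M] [T2Space M] [SecondCountableTopology M]
    [ChartedSpace (EuclideanSpace ℝ (Fin m)) M] [IsManifold (𝓡 m) ∞ M] :
    (∀ Et : GBundle.{w} G ((𝓡 n).prod (𝓡∂ 1)) (N × unitInterval),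
      ∃ E : GBundle.{w} G (𝓡 n) N,
        Nonempty (GIso Et
          (E.pullback (ContMDiffMap.fst : C^∞⟮(𝓡 n).prod (𝓡∂ 1), N × unitInterval; 𝓡 n, N⟯)))) ∧
    (∀ f₀ f₁ : C^∞⟮𝓡 n, N; 𝓡 m, M⟯,
      ContinuousMap.Homotopic (f₀ : C(N, M)) (f₁ : C(N, M)) →
        (VectG.pullback G f₀ : VectG.{w} G (𝓡 m) M → VectG.{w} G (𝓡 n) N) =
          VectG.pullback G f₁) ∧
    (ContractibleSpace M →
      ∀ E : GBundle.{w} G (𝓡 m) M, Nonempty (GIso E (GBundle.trivial G (𝓡 m) M))) := by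
  -- With second countability, local compactness provides the σ-compactness needed for bump
  -- coverings.
  have : LocallyCompactSpace N := ChartedSpace.locallyCompactSpace (EuclideanSpace ℝ (Fin n)) N
  have : LocallyCompactSpace M := ChartedSpace.locallyCompactSpace (EuclideanSpace ℝ (Fin m)) M
  refine ⟨fun Et => ⟨_, Et.nonempty_gIso_pullback_fst⟩, fun f₀ f₁ h => ?_,
    fun _ E => E.nonempty_gIso_trivial⟩
  funext c
  induction c using Quotient.inductionOn with
  | h E => exact Quotient.sound (E.nonempty_gIso_of_homotopic h)
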